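/- **Duality between theories and cotheories.** *Conventions.* A completely distributive lattice (CDL) is a complete lattice in which arbitrary joins distribute over arbitrary meets; CDL-morphisms preserve all joins and all meets; $2=\{0<1\}$. For a set $\Sigma$, let $\Sigma^\star$ be the free monoid and $\Sigma^\diamond$ the free CDL on the set $\Sigma^\star$ (the lattice of down-sets of the power set of $\Sigma^\star$). A *lattice bimodule* is a monoid $M$ and a CDL $D$ with a map $\iota\colon M\to D$ and a monoid biaction $\triangleright\colon M\times D\to D$, $\triangleleft\colon D\times M\to D$ that distributes over all joins and meets and satisfies $m\triangleright\iota(n)=\iota(mn)=\iota(m)\triangleleft n$; homomorphisms are pairs $h=(h^\star,h^\diamond)$ of a monoid homomorphism and a CDL-morphism preserving $\triangleright,\triangleleft,\iota$. The free lattice bimodule on $(\Sigma,\emptyset)$ is $(\Sigma^\star,\Sigma^\diamond)$, where $\iota$ is the inclusion of generators and the biaction extends the multiplication of words. An ideal of a poset is a nonempty, downwards closed, upwards directed subset. *Theories.* A *finite $\mathbb U$-quotient* of $\Sigma^\diamond$ is a surjective CDL-morphism $e\colon\Sigma^\diamond\to D$ onto a finite CDL $D$ such that for all $v,w\in\Sigma^\star$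 there is a CDL-morphism $\bar u\colon D\to D$ with $e(v\triangleright x\triangleleft w)=\bar u(e(x))$ for all $x\in \Sigma^\diamond$. Put $e_0\le e_1$ iff $e_0=k\cdot e_1$ for some CDL-morphism $k$, and identify $e_0,e_1$ if $e_0\le e_1\le e_0$. A *theory of $\mathbb U$-quotients* is a family $\mathscr T=(\mathscr T_\Sigma)_\Sigma$, indexed by the finite sets $\Sigma$, of ideals $\mathscr T_\Sigma$ of the poset of finite $\mathbb U$-quotients of $\Sigma^\diamond$, such that for every lattice bimodule homomorphism $h\colon(\Delta^\star,\Delta^\diamond)\to(\Sigma^\star,\Sigma^\diamond)$ and every $e\in\mathscr T_\Sigma$ there are $e'\in\mathscr T_\Delta$ and a CDL-morphism $\bar h$ with $e\cdot h^\diamond=\bar h\cdot e'$. *Cotheories.* A *local basic variety* over $\Sigma$ is a set $V$ of regular languages over $\Sigma$ such that $L\in V$ implies $v^{-1}Lw^{-1}=\{x\in \Sigma^\star: vxw\in L\}\in V$ for all $v,w\in\Sigma^\star$. A *basic cotheory of regular languages* is a family $(I_\Sigma)_\Sigma$, indexed by the finite sets, of ideals $I_\Sigma$ of the poset of finite local basic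 varieties over $\Sigma$ (ordered by inclusion), such that $F\in I_\Sigma$ implies $g^{-1}[F]=\{g^{-1}L: L\in F\}\in I_\Delta$ for each monoid homomorphism $g\colon\Delta^\star\to\Sigma^\star$. For a language $L\subseteq\Sigma^\star$ let $L^\diamond\colon\Sigma^\diamond\to 2$ be the CDL-morphism extending its characteristic function. For a finite $\mathbb U$-quotient $e\colon\Sigma^\diamond\to D$ let $\mathrm{rec}(e)$ be the set of languages $L\subseteq\Sigma^\star$ recognized by $e$, i.e. with $L^\diamond=p\cdot e$ for some CDL-morphism $p\colon D\to 2$. *Proposition.* Ordered by pointwise inclusion, the theories of $\mathbb U$-quotients form a lattice, the basic cotheories of regular languages form a lattice, and these two lattices are isomorphic. An isomorphism is given by $$\mathscr T\ \mapsto\ (I_\Sigma)_\Sigma,\qquad I_\Sigma=\{\mathrm{rec}(e) : e\in\mathscr T_\Sigma\}.$$ -/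

import Mathlib

universe u v u' v'

/-! ### The free completely distributive lattice on a set

Completely distributive lattices (CDLs) are types with `CompletelyDistribLattice`; their morphisms
(maps preserving all joins and all meets) are `CompleteLatticeHom`s.
The two-element lattice `2` is `Prop`. -/

/-- The free CDL on a set `X`: the lattice of downwards closed subsets of the power set of `X`. -/
abbrev FreeCDL (X : Type u) : Type u := LowerSet (Set X)

namespace FreeCDL

variable {X : Type u}

/-- The inclusion of the generators. -/
def of (x : X) : FreeCDL X := ⟨{S | x ∉ S}, fun _ _ hab hx h => hx (hab h)⟩

theorem mem_of {x : X} {S : Set X} : S ∈ of x ↔ x ∉ S := Iff.rfl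

/-- Every element is a join of meets of generators. -/
theorem eq_iSup_iInf_of (U : FreeCDL X) : U = ⨆ S ∈ U, ⨅ x ∈ Sᶜ, of x := by
  ext T
  simp only [SetLike.mem_coe, LowerSet.mem_iSup_iff, LowerSet.mem_iInf_iff, mem_of]
  constructor
  · intro hT
    exact ⟨T, hT, fun x hx => hx⟩
  · rintro ⟨S, hS, h⟩
    exact U.lower (fun x hx => by_contra fun hxS => h x hxS hx) hS

theorem hom_ext {D : Type v} [CompleteLattice D] {g h : CompleteLatticeHom (FreeCDL X) D}
    (H : ∀ x, g (of x) = h (of x)) : g = h := by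
  ext U
  rw [eq_iSup_iInf_of U]
  simp only [map_iSup, map_iInf, H]

/-- The unique CDL-morphism extending a map from the generators into a CDL. -/
def lift {D : Type v} [CompletelyDistribLattice D] (f : X → D) :
    CompleteLatticeHom (FreeCDL X) D where
  toFun U := ⨆ S : {S : Set X // S ∈ U}, ⨅ x : {x : X // x ∉ S.1}, f x.1
  map_sInf' 𝒰 := by
    apply le_antisymm
    · rw [sInf_image]
      refine le_iInf₂ fun U hU => iSup_le fun S => ?_
      exact le_iSup (fun S : {S : Set X // S ∈ U} => ⨅ x : {x : X // x ∉ S.1}, f x.1)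
        ⟨S.1, LowerSet.mem_sInf_iff.1 S.2 U hU⟩
    · rw [sInf_image', iInf_iSup_eq]
      refine iSup_le fun g => ?_
      have hmem : (⋂ U : 𝒰, (g U).1) ∈ sInf 𝒰 := by
        rw [LowerSet.mem_sInf_iff]
        intro U hU
        exact U.lower (Set.iInter_subset (fun U : 𝒰 => (g U).1) ⟨U, hU⟩) (g ⟨U, hU⟩).2
      refine le_trans ?_ (le_iSup (fun S : {S : Set X // S ∈ sInf 𝒰} =>
        ⨅ x : {x : X // x ∉ S.1}, f x.1) ⟨_, hmem⟩)
      refine le_iInf fun x => ?_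
      obtain ⟨U, hU⟩ : ∃ U : 𝒰, x.1 ∉ (g U).1 := by
        simpa using x.2
      exact (iInf_le _ U).trans (iInf_le (fun x : {x : X // x ∉ (g U).1} => f x.1) ⟨x.1, hU⟩)
  map_sSup' 𝒰 := by
    apply le_antisymm
    · refine iSup_le fun S => ?_
      obtain ⟨U, hU, hS⟩ := LowerSet.mem_sSup_iff.1 S.2
      refine le_trans ?_ (le_sSup (Set.mem_image_of_mem _ hU))
      exact le_iSup (fun S : {S : Set X // S ∈ U} => ⨅ x : {x : X // x ∉ S.1}, f x.1) ⟨S.1, hS⟩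
    · rw [sSup_image]
      refine iSup₂_le fun U hU => iSup_le fun S => ?_
      exact le_iSup (fun S : {S : Set X // S ∈ sSup 𝒰} => ⨅ x : {x : X // x ∉ S.1}, f x.1)
        ⟨S.1, LowerSet.mem_sSup_iff.2 ⟨U, hU, S.2⟩⟩

@[simp]
theorem lift_of {D : Type v} [CompletelyDistribLattice D] (f : X → D) (x : X) :
    lift f (of x) = f x := by
  change (⨆ S : {S : Set X // S ∈ of x}, ⨅ y : {y : X // y ∉ S.1}, f y.1) = f x
  apply le_antisymm
  · exact iSup_le fun S => iInf_le (fun y : {y : X // y ∉ S.1} => f y.1) ⟨x, S.2⟩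
  · refine le_trans ?_ (le_iSup (fun S : {S : Set X // S ∈ of x} =>
      ⨅ y : {y : X // y ∉ S.1}, f y.1) ⟨{x}ᶜ, fun h => h rfl⟩)
    refine le_iInf fun y => ?_
    have hy : y.1 = x := by simpa using y.2
    rw [hy]

end FreeCDL

/-! ### Lattice bimodules -/

/-- A lattice bimodule: a monoid `M`, a CDL `D`, a map `ι : M → D` and a biaction of `M` on `D`
distributing over all joins and meets and compatible with `ι`. -/
class LatticeBimodule (M : Type u) (D : Type v) [Monoid M] [CompletelyDistribLattice D] where
  ι : M → D
  /-- `actL m d` is `m ▷ d`. -/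
  actL : M → D → D
  /-- `actR d m` is `d ◁ m`. -/
  actR : D → M → D
  mul_actL : ∀ m n d, actL (m * n) d = actL m (actL n d)
  actR_mul : ∀ d m n, actR d (m * n) = actR (actR d m) n
  one_actL : ∀ d, actL 1 d = d
  actR_one : ∀ d, actR d 1 = d
  actL_actR : ∀ m d n, actR (actL m d) n = actL m (actR d n)
  actL_sSup : ∀ (m : M) (s : Set D), actL m (sSup s) = ⨆ d ∈ s, actL m d
  sSup_actR : ∀ (s : Set D) (m : M), actR (sSup s) m = ⨆ d ∈ s, actR d m
  actL_sInf : ∀ (m : M) (s : Set D), actL m (sInf s) = ⨅ d ∈ s, actL m d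
  sInf_actR : ∀ (s : Set D) (m : M), actR (sInf s) m = ⨅ d ∈ s, actR d m
  actL_ι : ∀ m n, actL m (ι n) = ι (m * n)
  ι_actR : ∀ m n, actR (ι m) n = ι (m * n)

namespace LatticeBimodule

/-- Homomorphisms of lattice bimodules. -/
structure Hom (M : Type u) (D : Type v) [Monoid M] [CompletelyDistribLattice D]
    [LatticeBimodule M D] (M' : Type u') (D' : Type v') [Monoid M'] [CompletelyDistribLattice D']
    [LatticeBimodule M' D'] where
  star : M →* M'
  diamond : CompleteLatticeHom D D'
  map_actL : ∀ (m : M) (d : D), diamond (actL m d) = actL (star m) (diamond d)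
  map_actR : ∀ (d : D) (m : M), diamond (actR d m) = actR (diamond d) (star m)
  map_ι : ∀ m : M, diamond (ι m) = ι (star m)

/-- The lattice bimodule on a monoid `M` and the free CDL on (the underlying set of) `M`, whose
action extends the multiplication of `M`. For `M = FreeMonoid A` it is the free lattice bimodule
on the pair of sets `(A, ∅)`. -/
instance freeOnMonoid (M : Type u) [Monoid M] : LatticeBimodule M (FreeCDL M) where
  ι := FreeCDL.of
  actL m := FreeCDL.lift fun x => FreeCDL.of (m * x)
  actR d m := FreeCDL.lift (fun x => FreeCDL.of (x * m)) d
  mul_actL m n d := by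
    have : FreeCDL.lift (fun x => FreeCDL.of (m * n * x)) =
        (FreeCDL.lift fun x => FreeCDL.of (m * x)).comp
          (FreeCDL.lift fun x => FreeCDL.of (n * x)) :=
      FreeCDL.hom_ext fun x => by simp [mul_assoc]
    exact DFunLike.congr_fun this d
  actR_mul d m n := by
    have : FreeCDL.lift (fun x => FreeCDL.of (x * (m * n))) =
        (FreeCDL.lift fun x => FreeCDL.of (x * n)).comp
          (FreeCDL.lift fun x => FreeCDL.of (x * m)) :=
      FreeCDL.hom_ext fun x => by simp [mul_assoc]
    exact DFunLike.congr_fun this d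
  one_actL d := by
    have : FreeCDL.lift (fun x : M => FreeCDL.of (1 * x)) = CompleteLatticeHom.id _ :=
      FreeCDL.hom_ext fun x => by simp
    exact DFunLike.congr_fun this d
  actR_one d := by
    have : FreeCDL.lift (fun x : M => FreeCDL.of (x * 1)) = CompleteLatticeHom.id _ :=
      FreeCDL.hom_ext fun x => by simp
    exact DFunLike.congr_fun this d
  actL_actR m d n := by
    have : (FreeCDL.lift fun x => FreeCDL.of (x * n)).comp
          (FreeCDL.lift fun x => FreeCDL.of (m * x)) =
        (FreeCDL.lift fun x => FreeCDL.of (m * x)).comp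
          (FreeCDL.lift fun x => FreeCDL.of (x * n)) :=
      FreeCDL.hom_ext fun x => by simp [mul_assoc]
    exact DFunLike.congr_fun this d
  actL_sSup m s := by rw [map_sSup, sSup_image]
  sSup_actR s m := by rw [map_sSup, sSup_image]
  actL_sInf m s := by rw [map_sInf, sInf_image]
  sInf_actR s m := by rw [map_sInf, sInf_image]
  actL_ι m n := by simp
  ι_actR m n := by simp

end LatticeBimodule

/-- The second sort `A^⋄` of the free lattice bimodule `(FreeMonoid A, FreeDiamond A)` on the
alphabet `A`: the free CDL on the set of words over `A`. -/
abbrev FreeDiamond (A : Type u) : Type u := FreeCDL (FreeMonoid A)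

/-! ### 𝕌-quotients and their theories -/

/-- A finite 𝕌-quotient of `A^⋄`: a surjective CDL-morphism `e` onto a finite CDL such that every
unary operation `x ↦ v ▷ x ◁ w` (for words `v, w`) lifts along `e`. -/
structure FinUQuotient (A : Type u) where
  D : Type u
  [cdl : CompletelyDistribLattice D]
  [fin : Finite D]
  e : CompleteLatticeHom (FreeDiamond A) D
  surj : Function.Surjective e
  lifts : ∀ v w : FreeMonoid A, ∃ ubar : CompleteLatticeHom D D, ∀ x : FreeDiamond A,
    e (LatticeBimodule.actR (LatticeBimodule.actL v x) w) = ubar (e x)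

namespace FinUQuotient

attribute [instance] FinUQuotient.cdl FinUQuotient.fin

variable {A : Type u}

/-- `e₀ ≤ e₁` iff `e₀` factorizes through `e₁`. As usual, quotients `e₀ ≤ e₁ ≤ e₀` represent the
same element of the poset of quotients. -/
instance : Preorder (FinUQuotient A) where
  le e₀ e₁ := ∃ h : CompleteLatticeHom e₁.D e₀.D, e₀.e = h.comp e₁.e
  le_refl e₀ := ⟨CompleteLatticeHom.id _, by ext; rfl⟩
  le_trans := by
    rintro a b c ⟨h, hh⟩ ⟨k, hk⟩
    exact ⟨h.comp k, by rw [hh, hk]; rfl⟩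

end FinUQuotient

/-- A theory of 𝕌-quotients: for each finite set `A` a local pseudovariety, i.e. an ideal
(a nonempty, downwards closed, directed subset) in the poset of finite 𝕌-quotients of `A^⋄`, such
that the composite of `h^⋄` with any member lifts through the family, for each homomorphism `h` of
free lattice bimodules. -/
@[ext]
structure UTheory where
  loc : ∀ (A : Type u) [Finite A], Order.Ideal (FinUQuotient A)
  lifts : ∀ (A B : Type u) [Finite A] [Finite B]
    (h : LatticeBimodule.Hom (FreeMonoid B) (FreeDiamond B) (FreeMonoid A) (FreeDiamond A)),
    ∀ q ∈ loc A, ∃ r ∈ loc B, ∃ hbar : CompleteLatticeHom r.D q.D,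
      q.e.comp h.diamond = hbar.comp r.e

/-- Theories are ordered by pointwise inclusion. -/
instance : PartialOrder UTheory.{u} where
  le T T' := ∀ (A : Type u) [Finite A], ∀ q ∈ T.loc A, q ∈ T'.loc A
  le_refl _ _ _ _ hq := hq
  le_trans _ _ _ h h' A _ q hq := h' A q (h A q hq)
  le_antisymm T T' h h' := by
    ext A _ q
    exact ⟨h A q, h' A q⟩

/-! ### Languages and basic cotheories -/

/-- The extension of (the characteristic function of) a language `L` to a CDL-morphism
`L^⋄ : A^⋄ → 2`. -/
def Language.diamond {A : Type u} (L : Language A) : CompleteLatticeHom (FreeDiamond A) Prop :=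
  FreeCDL.lift fun x : FreeMonoid A => x.toList ∈ L

/-- `rec(e)`, the set of languages recognized by a finite 𝕌-quotient. -/
def FinUQuotient.recognized {A : Type u} (q : FinUQuotient A) : Set (Language A) :=
  {L | ∃ p : CompleteLatticeHom q.D Prop, L.diamond = p.comp q.e}

/-- The derivative `v⁻¹Lw⁻¹ = {x | v x w ∈ L}`. -/
def Language.derivative {A : Type u} (L : Language A) (v w : List A) : Language A :=
  {x : List A | v ++ x ++ w ∈ L}

/-- The preimage `g⁻¹L` of a language under a monoid homomorphism. -/
def Language.preimage {A B : Type u} (g : FreeMonoid B →* FreeMonoid A) (L : Language A) :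
    Language B :=
  {x : List B | (g (FreeMonoid.ofList x)).toList ∈ L}

/-- A local basic variety: a set of regular languages closed under derivatives. -/
def IsLocalBasicVariety {A : Type u} (V : Set (Language A)) : Prop :=
  (∀ L ∈ V, L.IsRegular) ∧ ∀ L ∈ V, ∀ v w : List A, L.derivative v w ∈ V

/-- A basic cotheory of regular languages: for each finite set `A` an ideal (a nonempty, downwards
closed, directed subset) in the poset of finite local basic varieties over `A`, ordered by
inclusion, such that the family is closed under preimages of monoid homomorphisms. -/
@[ext]
structure BasicCotheory where
  loc : ∀ (A : Type u) [Finite A], Set (Set (Language A))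
  finite_variety : ∀ (A : Type u) [Finite A], ∀ F ∈ loc A, F.Finite ∧ IsLocalBasicVariety F
  nonempty : ∀ (A : Type u) [Finite A], (loc A).Nonempty
  down_closed : ∀ (A : Type u) [Finite A], ∀ F ∈ loc A, ∀ F' ⊆ F,
    IsLocalBasicVariety F' → F' ∈ loc A
  directed : ∀ (A : Type u) [Finite A], DirectedOn (· ⊆ ·) (loc A)
  preimage : ∀ (A B : Type u) [Finite A] [Finite B] (g : FreeMonoid B →* FreeMonoid A),
    ∀ F ∈ loc A, Language.preimage g '' F ∈ loc B

/-- Cotheories are ordered by pointwise inclusion. -/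
instance : PartialOrder BasicCotheory.{u} where
  le T T' := ∀ (A : Type u) [Finite A], T.loc A ⊆ T'.loc A
  le_refl _ _ _ := subset_rfl
  le_trans _ _ _ h h' A _ := (h A).trans (h' A)
  le_antisymm T T' h h' := by
    ext A _ F
    exact ⟨fun hF => h A hF, fun hF => h' A hF⟩

/-! This is finite Birkhoff duality. Morphisms into 2 separate the points of a finite distributive
lattice, so the kernel of a finite 𝕌-quotient `q` is determined by `q.recognized`, and `q ≤ r` holds
iff `q.recognized ⊆ r.recognized` (`le_iff_recognized_subset`). Conversely, a finite local basic
variety `F` is recognized by the image of `A^⋄` in `2^F`, and by nothing smaller or larger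
(`exists_recognized_eq`). So finite quotients up to equivalence and finite local basic varieties
form isomorphic posets, with the same ideals. Precomposing `L^⋄` with `h^⋄` gives the extension of
the preimage of `L` under `h^⋆`; hence lifting along `h` means recognizing preimages
(`exists_lift_iff`), which matches the two compatibility conditions. Binary joins and meets are
built for cotheories and transported to theories. -/

/-! ### Factorization through surjections, and morphisms into 2. -/

namespace CompleteLatticeHom

/-- A morphism whose kernel contains that of a surjective morphism `e` factorizes through `e`. -/
theorem exists_comp_eq_of_surjective {X D E : Type*} [CompleteLattice X] [CompleteLattice D]
    [CompleteLattice E] {e : CompleteLatticeHom X D} (he : Function.Surjective e)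
    (f : CompleteLatticeHom X E) (hf : ∀ x y, e x = e y → f x = f y) :
    ∃ k : CompleteLatticeHom D E, f = k.comp e := by
  have hs : ∀ x, f (Function.surjInv he (e x)) = f x := fun x =>
    hf _ _ (Function.surjInv_eq he _)
  have himage : ∀ s : Set D, e '' (Function.surjInv he '' s) = s := fun s => by
    simp [Set.image_image, Function.surjInv_eq he]
  refine ⟨⟨⟨fun d => f (Function.surjInv he d), fun s => ?_⟩, fun s => ?_⟩, ?_⟩
  -- The section need not preserve meets, but `e` sends this meet of chosen preimages to `sInf s`,
  -- and `f` depends only on the value of `e`.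
  · have h := hs (sInf (Function.surjInv he '' s))
    rw [map_sInf, himage, map_sInf, Set.image_image] at h
    exact h
  · have h := hs (sSup (Function.surjInv he '' s))
    rw [map_sSup, himage, map_sSup, Set.image_image] at h
    exact h
  · ext x
    exact (hs x).symm

/-- The morphism into a product of copies of `2` induced by a family of morphisms into `2`. -/
def piProp {X : Type*} [CompleteLattice X] {ι : Type*} (f : ι → CompleteLatticeHom X Prop) :
    CompleteLatticeHom X (ι → Prop) where
  toFun x i := f i x
  map_sInf' s := by
    funext i
    rw [map_sInf, sInf_image, sInf_image]
    simp only [iInf_apply]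
  map_sSup' s := by
    funext i
    rw [map_sSup, sSup_image, sSup_image]
    simp only [iSup_apply]

/-- A supremum-prime element of a finite lattice induces a morphism into `2`. -/
def ofSupPrime {D : Type*} [CompleteLattice D] [Finite D] (j : D) (hj : SupPrime j) :
    CompleteLatticeHom D Prop where
  toFun x := j ≤ x
  map_sInf' s := by
    rw [sInf_image]
    simp
  map_sSup' s := by
    rw [sSup_image]
    have hs := s.toFinite
    -- Primeness concerns finite joins only; finiteness of `D` makes every join finite.
    have hsup : sSup s = hs.toFinset.sup id := by simp [Finset.sup_id_eq_sSup]
    rw [hsup, hj.le_finset_sup]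
    simp

theorem ofSupPrime_apply {D : Type*} [CompleteLattice D] [Finite D] (j : D) (hj : SupPrime j)
    (x : D) : ofSupPrime j hj x = (j ≤ x) := rfl

/-- The morphisms into `2` separate the points of a finite distributive lattice. -/
theorem eq_of_forall_prop {D : Type*} [CompletelyDistribLattice D] [Finite D] {a b : D}
    (h : ∀ p : CompleteLatticeHom D Prop, p a = p b) : a = b := by
  have key : ∀ a b : D, (∀ p : CompleteLatticeHom D Prop, p a = p b) → a ≤ b := by
    intro a b h
    -- By distributivity each irreducible component `j` of `a` is prime, so the test morphism `j ≤
    -- ·` transfers `j ≤ a` to `j ≤ b`.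
    obtain ⟨s, rfl, hs⟩ := exists_supIrred_decomposition a
    refine Finset.sup_le fun j hj => ?_
    have := h (ofSupPrime j (supPrime_iff_supIrred.2 (hs hj)))
    rw [ofSupPrime_apply, ofSupPrime_apply] at this
    exact this.mp (Finset.le_sup (f := id) hj)
  exact le_antisymm (key a b h) (key b a fun p => (h p).symm)

/-- Every morphism from the image of `piProp f` into `2` is induced by a member of the family. -/
theorem exists_eq_of_piProp_comp {X D : Type*} [CompleteLattice X] [CompleteLattice D] {ι : Type*}
    (f : ι → CompleteLatticeHom X Prop) {e : CompleteLatticeHom X D}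
    (i : CompleteLatticeHom D (ι → Prop)) (hi : Function.Injective i)
    (hie : ∀ x, i (e x) = piProp f x) (p : CompleteLatticeHom D Prop) :
    ∃ k, p.comp e = f k := by
  -- Since `p` preserves meets, it is the principal filter of `d₀`.
  set d₀ : D := sInf {d | p d} with hd₀
  have hpd₀ : p d₀ := by
    rw [hd₀, map_sInf, sInf_image]
    simp
  have hle : ∀ d, p d ↔ d₀ ≤ d := fun d =>
    ⟨fun h => sInf_le h, fun h => OrderHomClass.mono p h hpd₀⟩
  -- A coordinate whose filter is also generated by `d₀` equals `p`. If none exists, each coordinate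
  -- true at `d₀` is true at some `g k` not above `d₀`. The join of these `g k` lies above `d₀`, as
  -- `i` reflects the order, so `p` holds at one of them, a contradiction.
  obtain ⟨k, hk, hmin⟩ : ∃ k, i d₀ k ∧ ∀ d, i d k → d₀ ≤ d := by
    by_contra! hcon
    choose! g hg hng using hcon
    have hsup : d₀ ≤ ⨆ k : {k // i d₀ k}, g k.1 := by
      have himp : i d₀ ≤ i (⨆ k : {k // i d₀ k}, g k.1) := by
        intro k hk
        rw [map_iSup, iSup_apply, iSup_Prop_eq]
        exact ⟨⟨k, hk⟩, hg k hk⟩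
      have hinf : i (d₀ ⊓ ⨆ k : {k // i d₀ k}, g k.1) = i d₀ := by
        rw [map_inf, inf_eq_left.2 himp]
      exact inf_eq_left.1 (hi hinf)
    have hp := (hle _).2 hsup
    rw [map_iSup, iSup_Prop_eq] at hp
    obtain ⟨k, hk⟩ := hp
    exact hng k.1 k.2 ((hle _).1 hk)
  refine ⟨k, ?_⟩
  ext x
  have hx : i (e x) k ↔ f k x := by rw [hie]; rfl
  change p (e x) ↔ f k x
  rw [hle, ← hx]
  exact ⟨fun h => OrderHomClass.mono i h k hk, hmin _⟩

end CompleteLatticeHom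

/-- A complete sublattice of a completely distributive lattice is completely distributive. -/
noncomputable abbrev CompleteSublattice.completelyDistribLattice {α : Type*}
    [CompletelyDistribLattice α] (S : CompleteSublattice α) : CompletelyDistribLattice S :=
  .ofMinimalAxioms
    { iInf_iSup_eq := fun f => Subtype.coe_injective <| by
        simp only [CompleteSublattice.coe_iInf, CompleteSublattice.coe_iSup]
        exact iInf_iSup_eq }

/-! ### Languages as morphisms into 2. -/

namespace Language

variable {A B : Type u}

@[simp]
theorem diamond_of (L : Language A) (x : FreeMonoid A) :
    L.diamond (FreeCDL.of x) = (x.toList ∈ L) :=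
  FreeCDL.lift_of _ _

theorem exists_eq_diamond (p : CompleteLatticeHom (FreeDiamond A) Prop) :
    ∃ L : Language A, p = L.diamond :=
  let L : Language A := {x : List A | p (FreeCDL.of (FreeMonoid.ofList x))}
  ⟨L, FreeCDL.hom_ext fun x => (L.diamond_of x).symm⟩

theorem diamond_injective : Function.Injective (diamond : Language A → _) := by
  intro L L' h
  ext x
  have := DFunLike.congr_fun h (FreeCDL.of (FreeMonoid.ofList x))
  rw [diamond_of, diamond_of] at this
  exact this.to_iff

/-- The two-sided translation `x ↦ v ▷ x ◁ w` as a morphism. -/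
def translate (v w : FreeMonoid A) : CompleteLatticeHom (FreeDiamond A) (FreeDiamond A) :=
  (FreeCDL.lift fun x => FreeCDL.of (x * w)).comp (FreeCDL.lift fun x => FreeCDL.of (v * x))

/-- Derivatives are dual to translations; this turns closure under derivatives into the lifting of
unary operations. -/
theorem diamond_comp_translate (L : Language A) (v w : FreeMonoid A) :
    L.diamond.comp (translate v w) = (L.derivative v.toList w.toList).diamond :=
  FreeCDL.hom_ext fun x => by
    rw [diamond_of]
    simp only [translate, CompleteLatticeHom.comp_apply, FreeCDL.lift_of, diamond_of]
    rfl

/-- Compatibility with `ι` fixes `h.diamond` on generators, so only `h.star` matters. -/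
theorem diamond_comp_hom (L : Language A)
    (h : LatticeBimodule.Hom (FreeMonoid B) (FreeDiamond B) (FreeMonoid A) (FreeDiamond A)) :
    L.diamond.comp h.diamond = (L.preimage h.star).diamond :=
  FreeCDL.hom_ext fun x => by
    have hx : h.diamond (FreeCDL.of x) = FreeCDL.of (h.star x) := h.map_ι x
    rw [diamond_of, CompleteLatticeHom.comp_apply, hx, diamond_of]
    rfl

theorem derivative_preimage (g : FreeMonoid B →* FreeMonoid A) (L : Language A) (v w : List B) :
    (L.preimage g).derivative v w = (L.derivative (g (FreeMonoid.ofList v)).toList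
      (g (FreeMonoid.ofList w)).toList).preimage g := by
  ext x
  change (g (FreeMonoid.ofList (v ++ x ++ w))).toList ∈ L ↔ (g (FreeMonoid.ofList v)).toList ++
    (g (FreeMonoid.ofList x)).toList ++ (g (FreeMonoid.ofList w)).toList ∈ L
  simp only [FreeMonoid.ofList_append, map_mul, FreeMonoid.toList_mul]

end Language

/-- The homomorphism of free lattice bimodules induced by a monoid homomorphism. -/
def LatticeBimodule.Hom.ofMonoidHom {A B : Type u} (g : FreeMonoid B →* FreeMonoid A) :
    LatticeBimodule.Hom (FreeMonoid B) (FreeDiamond B) (FreeMonoid A) (FreeDiamond A) where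
  star := g
  diamond := FreeCDL.lift fun x => FreeCDL.of (g x)
  map_actL m d := by
    have : (FreeCDL.lift fun x => FreeCDL.of (g x)).comp
          (FreeCDL.lift fun x => FreeCDL.of (m * x)) =
        (FreeCDL.lift fun x => FreeCDL.of (g m * x)).comp
          (FreeCDL.lift fun x => FreeCDL.of (g x)) :=
      FreeCDL.hom_ext fun x => by simp
    exact DFunLike.congr_fun this d
  map_actR d m := by
    have : (FreeCDL.lift fun x => FreeCDL.of (g x)).comp
          (FreeCDL.lift fun x => FreeCDL.of (x * m)) =
        (FreeCDL.lift fun x => FreeCDL.of (x * g m)).comp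
          (FreeCDL.lift fun x => FreeCDL.of (g x)) :=
      FreeCDL.hom_ext fun x => by simp
    exact DFunLike.congr_fun this d
  map_ι m := FreeCDL.lift_of _ m

/-! ### Finite local basic varieties. -/

/-- Finite sets of languages closed under derivatives consist of regular languages. -/
theorem isLocalBasicVariety_of_finite {A : Type u} {F : Set (Language A)} (hF : F.Finite)
    (hd : ∀ L ∈ F, ∀ v w : List A, L.derivative v w ∈ F) : IsLocalBasicVariety F := by
  -- Myhill–Nerode: left quotients are derivatives with empty right word, so all of them lie in the
  -- finite set `F`.
  refine ⟨fun L hL => .of_finite_range_leftQuotient (hF.subset ?_), hd⟩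
  rintro _ ⟨x, rfl⟩
  have : L.leftQuotient x = L.derivative x [] := by
    ext y
    change x ++ y ∈ L ↔ x ++ y ++ [] ∈ L
    rw [List.append_nil]
  exact this ▸ hd L hL x []

namespace IsLocalBasicVariety

variable {A B : Type u}

protected theorem empty : IsLocalBasicVariety (∅ : Set (Language A)) := by
  simp [IsLocalBasicVariety]

theorem union {F G : Set (Language A)} (hF : IsLocalBasicVariety F) (hG : IsLocalBasicVariety G) :
    IsLocalBasicVariety (F ∪ G) :=
  ⟨fun L hL => hL.elim (hF.1 L) (hG.1 L),
    fun L hL v w => hL.imp (fun h => hF.2 L h v w) (fun h => hG.2 L h v w)⟩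

theorem image_preimage {F : Set (Language A)} (hF : IsLocalBasicVariety F) (hfin : F.Finite)
    (g : FreeMonoid B →* FreeMonoid A) : IsLocalBasicVariety (Language.preimage g '' F) := by
  refine isLocalBasicVariety_of_finite (hfin.image _) ?_
  rintro _ ⟨L, hL, rfl⟩ v w
  rw [Language.derivative_preimage]
  exact Set.mem_image_of_mem _ (hF.2 L hL _ _)

end IsLocalBasicVariety

/-! ### Quotients versus the languages they recognize. -/

namespace FinUQuotient

variable {A B : Type u}

theorem comp_mem_recognized (q : FinUQuotient A) (p : CompleteLatticeHom q.D Prop) :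
    ∃ L ∈ q.recognized, L.diamond = p.comp q.e := by
  obtain ⟨L, hL⟩ := Language.exists_eq_diamond (p.comp q.e)
  exact ⟨L, ⟨p, hL.symm⟩, hL.symm⟩

theorem finite_recognized (q : FinUQuotient A) : q.recognized.Finite := by
  have : Finite (CompleteLatticeHom q.D Prop) := DFunLike.finite _
  refine Set.Finite.of_finite_image (f := Language.diamond) ((Set.finite_range
    fun p : CompleteLatticeHom q.D Prop => p.comp q.e).subset ?_) Language.diamond_injective.injOn
  rintro _ ⟨L, ⟨p, hp⟩, rfl⟩
  exact ⟨p, hp.symm⟩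

/-- If `p` recognizes `L`, then `p` composed with the lifted translation recognizes the derivative.
-/
theorem isLocalBasicVariety_recognized (q : FinUQuotient A) :
    IsLocalBasicVariety q.recognized := by
  refine isLocalBasicVariety_of_finite q.finite_recognized ?_
  rintro L ⟨p, hp⟩ v w
  obtain ⟨u, hu⟩ := q.lifts (FreeMonoid.ofList v) (FreeMonoid.ofList w)
  refine ⟨p.comp u, ?_⟩
  have h := L.diamond_comp_translate (FreeMonoid.ofList v) (FreeMonoid.ofList w)
  simp only [FreeMonoid.toList_ofList] at h
  rw [← h, hp]
  refine DFunLike.ext _ _ fun x => ?_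
  exact congrArg p (hu x)

/-- Two elements are identified by `q` iff no language recognized by `q` separates them. -/
theorem apply_eq_iff (q : FinUQuotient A) (x y : FreeDiamond A) :
    q.e x = q.e y ↔ ∀ L ∈ q.recognized, L.diamond x = L.diamond y := by
  constructor
  · rintro h L ⟨p, hp⟩
    rw [hp, CompleteLatticeHom.comp_apply, CompleteLatticeHom.comp_apply, h]
  · refine fun h => CompleteLatticeHom.eq_of_forall_prop fun p => ?_
    obtain ⟨L, hL, hp⟩ := q.comp_mem_recognized p
    have := h L hL
    rwa [hp] at this

/-- The composite of `q` with a homomorphism lifts along `r` iff `r` recognizes all preimages of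
languages recognized by `q`. -/
theorem exists_lift_iff (q : FinUQuotient A) (r : FinUQuotient B)
    (h : LatticeBimodule.Hom (FreeMonoid B) (FreeDiamond B) (FreeMonoid A) (FreeDiamond A)) :
    (∃ hbar : CompleteLatticeHom r.D q.D, q.e.comp h.diamond = hbar.comp r.e) ↔
      Language.preimage h.star '' q.recognized ⊆ r.recognized := by
  constructor
  · rintro ⟨k, hk⟩ _ ⟨L, ⟨p, hp⟩, rfl⟩
    refine ⟨p.comp k, ?_⟩
    rw [← Language.diamond_comp_hom, hp, CompleteLatticeHom.comp_assoc, hk,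
      CompleteLatticeHom.comp_assoc]
  · refine fun hsub => CompleteLatticeHom.exists_comp_eq_of_surjective r.surj _ fun x y hxy => ?_
    refine (q.apply_eq_iff _ _).2 fun L hL => ?_
    have := (r.apply_eq_iff x y).1 hxy _ (hsub (Set.mem_image_of_mem _ hL))
    rwa [← Language.diamond_comp_hom] at this

/-- Inclusion of recognized languages gives inclusion of kernels by `apply_eq_iff`, hence a
factorization. -/
theorem le_iff_recognized_subset (q r : FinUQuotient A) :
    q ≤ r ↔ q.recognized ⊆ r.recognized := by
  constructor
  · rintro ⟨k, hk⟩ L ⟨p, hp⟩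
    exact ⟨p.comp k, by rw [hp, hk, CompleteLatticeHom.comp_assoc]⟩
  · refine fun h => CompleteLatticeHom.exists_comp_eq_of_surjective r.surj _ fun x y hxy => ?_
    exact (q.apply_eq_iff x y).2 fun L hL => (r.apply_eq_iff x y).1 hxy L (h hL)

/-- Every finite local basic variety is the set of languages recognized by a quotient. -/
theorem exists_recognized_eq {F : Set (Language A)} (hfin : F.Finite)
    (hF : IsLocalBasicVariety F) : ∃ q : FinUQuotient A, q.recognized = F := by
  have : Finite F := hfin
  let f : F → CompleteLatticeHom (FreeDiamond A) Prop := fun L => L.1.diamond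
  let e := CompleteLatticeHom.piProp f
  let S := e.range
  let _ : CompletelyDistribLattice S := S.completelyDistribLattice
  let e' : CompleteLatticeHom (FreeDiamond A) S :=
    { toFun := fun x => ⟨e x, x, rfl⟩
      map_sInf' := fun s => Subtype.ext <| by
        refine (map_sInf e s).trans ?_
        exact congrArg sInf (Set.image_image Subtype.val (fun x => (⟨e x, x, rfl⟩ : S)) s).symm
      map_sSup' := fun s => Subtype.ext <| by
        refine (map_sSup e s).trans ?_
        exact congrArg sSup (Set.image_image Subtype.val (fun x => (⟨e x, x, rfl⟩ : S)) s).symm }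
  let i : CompleteLatticeHom S (F → Prop) :=
    { toFun := Subtype.val, map_sInf' := fun _ => rfl, map_sSup' := fun _ => rfl }
  have hsurj : Function.Surjective e' := fun ⟨_, x, hx⟩ => ⟨x, Subtype.ext hx⟩
  have he' : ∀ x y, e' x = e' y ↔ ∀ L ∈ F, L.diamond x = L.diamond y := fun x y =>
    ⟨fun h L hL => congrFun (congrArg Subtype.val h) ⟨L, hL⟩,
      fun h => Subtype.ext (funext fun L => h L.1 L.2)⟩
  have hlift : ∀ v w : FreeMonoid A, ∃ ubar : CompleteLatticeHom S S,
      e'.comp (Language.translate v w) = ubar.comp e' := fun v w => by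
    refine CompleteLatticeHom.exists_comp_eq_of_surjective hsurj _ fun x y hxy => ?_
    refine (he' _ _).2 fun L hL => ?_
    -- Closure of `F` under derivatives makes the kernel of `e'` invariant under translations.
    have := (he' x y).1 hxy _ (hF.2 L hL v.toList w.toList)
    rwa [← Language.diamond_comp_translate] at this
  refine ⟨⟨S, e', hsurj, fun v w => (hlift v w).imp fun u hu x => DFunLike.congr_fun hu x⟩, ?_⟩
  ext L
  constructor
  · rintro ⟨p, hp⟩
    -- Nothing outside `F` is recognized: every morphism from the image into 2 is a coordinate.
    obtain ⟨k, hk⟩ := CompleteLatticeHom.exists_eq_of_piProp_comp f (e := e') i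
      Subtype.coe_injective (fun _ => rfl) p
    exact Language.diamond_injective (hp.trans hk) ▸ k.2
  · exact fun hL => CompleteLatticeHom.exists_comp_eq_of_surjective hsurj _
      fun x y hxy => (he' x y).1 hxy L hL

end FinUQuotient

/-! ### The lattice of cotheories. -/

namespace BasicCotheory

variable (C₁ C₂ : BasicCotheory.{u})

theorem empty_mem (C : BasicCotheory.{u}) (A : Type u) [Finite A] : ∅ ∈ C.loc A := by
  obtain ⟨F, hF⟩ := C.nonempty A
  exact C.down_closed A F hF ∅ (Set.empty_subset _) .empty

theorem union_mem (C : BasicCotheory.{u}) {A : Type u} [Finite A] {F G : Set (Language A)}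
    (hF : F ∈ C.loc A) (hG : G ∈ C.loc A) : F ∪ G ∈ C.loc A := by
  obtain ⟨H, hH, hFH, hGH⟩ := C.directed A F hF G hG
  exact C.down_closed A H hH _ (Set.union_subset hFH hGH)
    ((C.finite_variety A F hF).2.union (C.finite_variety A G hG).2)

/-- The pointwise intersection of two cotheories. -/
def inf : BasicCotheory.{u} where
  loc A _ := C₁.loc A ∩ C₂.loc A
  finite_variety A _ F hF := C₁.finite_variety A F hF.1
  nonempty A _ := ⟨∅, C₁.empty_mem A, C₂.empty_mem A⟩
  down_closed A _ F hF F' h hF' :=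
    ⟨C₁.down_closed A F hF.1 F' h hF', C₂.down_closed A F hF.2 F' h hF'⟩
  directed _ _ F hF G hG := ⟨F ∪ G, ⟨C₁.union_mem hF.1 hG.1, C₂.union_mem hF.2 hG.2⟩,
    Set.subset_union_left, Set.subset_union_right⟩
  preimage A B _ _ g F hF := ⟨C₁.preimage A B g F hF.1, C₂.preimage A B g F hF.2⟩

/-- The cotheory generated by two cotheories. -/
def sup : BasicCotheory.{u} where
  -- All varieties below a union are admitted, so down-closure is immediate.
  loc A _ := {H | IsLocalBasicVariety H ∧ ∃ F ∈ C₁.loc A, ∃ G ∈ C₂.loc A, H ⊆ F ∪ G}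
  finite_variety A _ := by
    rintro H ⟨hH, F, hF, G, hG, h⟩
    exact ⟨((C₁.finite_variety A F hF).1.union (C₂.finite_variety A G hG).1).subset h, hH⟩
  nonempty A _ := ⟨∅, .empty, ∅, C₁.empty_mem A, ∅, C₂.empty_mem A, Set.empty_subset _⟩
  down_closed A _ := by
    rintro H ⟨-, F, hF, G, hG, h⟩ H' hH' hv
    exact ⟨hv, F, hF, G, hG, hH'.trans h⟩
  directed A _ := by
    rintro H ⟨hH, F, hF, G, hG, h⟩ H' ⟨hH', F', hF', G', hG', h'⟩
    refine ⟨H ∪ H', ⟨hH.union hH', F ∪ F', C₁.union_mem hF hF', G ∪ G', C₂.union_mem hG hG', ?_⟩,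
      Set.subset_union_left, Set.subset_union_right⟩
    rw [Set.union_union_union_comm]
    exact Set.union_subset_union h h'
  preimage A B _ _ g := by
    rintro H ⟨hH, F, hF, G, hG, h⟩
    refine ⟨hH.image_preimage (((C₁.finite_variety A F hF).1.union
      (C₂.finite_variety A G hG).1).subset h) g, _, C₁.preimage A B g F hF, _,
      C₂.preimage A B g G hG, ?_⟩
    rw [← Set.image_union]
    exact Set.image_mono h

theorem isGLB_inf : IsGLB {C₁, C₂} (C₁.inf C₂) := by
  constructor
  · rintro C (rfl | rfl) A _ F hF
    exacts [hF.1, hF.2]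
  · intro C hC A _ F hF
    exact ⟨hC (Set.mem_insert _ _) A hF, hC (Set.mem_insert_of_mem _ rfl) A hF⟩

theorem isLUB_sup : IsLUB {C₁, C₂} (C₁.sup C₂) := by
  constructor
  · rintro C (rfl | rfl) A _ F hF
    · exact ⟨(C.finite_variety A F hF).2, F, hF, ∅, C₂.empty_mem A, Set.subset_union_left⟩
    · exact ⟨(C.finite_variety A F hF).2, ∅, C₁.empty_mem A, F, hF, Set.subset_union_right⟩
  · rintro C hC A _ H ⟨hH, F, hF, G, hG, h⟩
    exact C.down_closed A _ (C.union_mem (hC (Set.mem_insert _ _) A hF)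
      (hC (Set.mem_insert_of_mem _ rfl) A hG)) H h hH

/-! ### The mutually inverse constructions. -/

/-- The theory of all quotients whose recognized languages form a member of the cotheory. -/
def toTheory (C : BasicCotheory.{u}) : UTheory.{u} where
  loc A _ :=
    { carrier := {q | q.recognized ∈ C.loc A}
      lower' := fun q r hrq hq => C.down_closed A _ hq _
        ((r.le_iff_recognized_subset q).1 hrq) r.isLocalBasicVariety_recognized
      nonempty' := by
        obtain ⟨q, hq⟩ := FinUQuotient.exists_recognized_eq Set.finite_empty
          (IsLocalBasicVariety.empty (A := A))
        refine ⟨q, ?_⟩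
        change q.recognized ∈ C.loc A
        exact hq ▸ C.empty_mem A
      directed' := by
        intro q hq r hr
        obtain ⟨H, hH, hqH, hrH⟩ := C.directed A _ hq _ hr
        obtain ⟨s, rfl⟩ := FinUQuotient.exists_recognized_eq (C.finite_variety A H hH).1
          (C.finite_variety A H hH).2
        exact ⟨s, hH, (q.le_iff_recognized_subset s).2 hqH, (r.le_iff_recognized_subset s).2 hrH⟩ }
  lifts A B _ _ h q hq := by
    have hF := C.preimage A B h.star _ hq
    obtain ⟨r, hr⟩ := FinUQuotient.exists_recognized_eq (C.finite_variety B _ hF).1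
      (C.finite_variety B _ hF).2
    have hrC : r.recognized ∈ C.loc B := hr ▸ hF
    exact ⟨r, hrC, (q.exists_lift_iff r h).2 hr.ge⟩

end BasicCotheory

namespace UTheory

/-- The cotheory of all sets of languages recognized by the members of a theory. -/
def toCotheory (T : UTheory.{u}) : BasicCotheory.{u} where
  loc A _ := {F | ∃ q ∈ T.loc A, F = q.recognized}
  finite_variety A _ := by
    rintro _ ⟨q, -, rfl⟩
    exact ⟨q.finite_recognized, q.isLocalBasicVariety_recognized⟩
  nonempty A _ := by
    obtain ⟨q, hq⟩ := (T.loc A).nonempty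
    exact ⟨_, q, hq, rfl⟩
  down_closed A _ := by
    rintro _ ⟨q, hq, rfl⟩ F hF hv
    obtain ⟨r, rfl⟩ := FinUQuotient.exists_recognized_eq (q.finite_recognized.subset hF) hv
    exact ⟨r, (T.loc A).lower ((r.le_iff_recognized_subset q).2 hF) hq, rfl⟩
  directed A _ := by
    rintro _ ⟨q, hq, rfl⟩ _ ⟨r, hr, rfl⟩
    obtain ⟨s, hs, hqs, hrs⟩ := (T.loc A).directed q hq r hr
    exact ⟨_, ⟨s, hs, rfl⟩, (q.le_iff_recognized_subset s).1 hqs,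
      (r.le_iff_recognized_subset s).1 hrs⟩
  preimage A B _ _ g := by
    rintro _ ⟨q, hq, rfl⟩
    obtain ⟨r, hr, hlift⟩ := T.lifts A B (.ofMonoidHom g) q hq
    have hsub : Language.preimage g '' q.recognized ⊆ r.recognized :=
      (q.exists_lift_iff r (.ofMonoidHom g)).1 hlift
    obtain ⟨s, hs⟩ := FinUQuotient.exists_recognized_eq (q.finite_recognized.image _)
      (q.isLocalBasicVariety_recognized.image_preimage q.finite_recognized g)
    -- The lift only places the preimages inside `r.recognized`; the quotient `s` recognizing
    -- exactly them lies below `r`, hence in the ideal.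
    exact ⟨s, (T.loc B).lower ((s.le_iff_recognized_subset r).2 (hs.trans_subset hsub)) hr,
      hs.symm⟩

/-- Quotients with the same languages are equivalent in the preorder, and a lower set cannot
distinguish them. -/
theorem recognized_mem_toCotheory (T : UTheory.{u}) {A : Type u} [Finite A] {q : FinUQuotient A} :
    q.recognized ∈ T.toCotheory.loc A ↔ q ∈ T.loc A := by
  constructor
  · rintro ⟨r, hr, h⟩
    exact (T.loc A).lower ((q.le_iff_recognized_subset r).2 h.le) hr
  · exact fun hq => ⟨q, hq, rfl⟩

/-- The isomorphism between theories of 𝕌-quotients and basic cotheories. -/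
def cotheoryIso : UTheory.{u} ≃o BasicCotheory.{u} where
  toFun := toCotheory
  invFun := BasicCotheory.toTheory
  left_inv T := by
    ext A _ q
    exact T.recognized_mem_toCotheory
  right_inv C := by
    ext A _ F
    constructor
    · rintro ⟨q, hq, rfl⟩
      exact hq
    · intro hF
      obtain ⟨q, rfl⟩ := FinUQuotient.exists_recognized_eq (C.finite_variety A F hF).1
        (C.finite_variety A F hF).2
      exact ⟨q, hF, rfl⟩
  map_rel_iff' {T T'} := by
    constructor
    · intro h A _ q hq
      exact T'.recognized_mem_toCotheory.1 (h A (T.recognized_mem_toCotheory.2 hq))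
    · rintro h A _ _ ⟨q, hq, rfl⟩
      exact ⟨q, h A q hq, rfl⟩

end UTheory

theorem mainTheorem4 :
    (∀ T₁ T₂ : UTheory.{u}, (∃ S, IsLUB {T₁, T₂} S) ∧ ∃ S, IsGLB {T₁, T₂} S) ∧
    (∀ C₁ C₂ : BasicCotheory.{u}, (∃ S, IsLUB {C₁, C₂} S) ∧ ∃ S, IsGLB {C₁, C₂} S) ∧
    ∃ Φ : UTheory.{u} ≃o BasicCotheory.{u}, ∀ (T : UTheory.{u}) (A : Type u) [Finite A],
      (Φ T).loc A = {F | ∃ q ∈ T.loc A, F = q.recognized} := by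
  refine ⟨fun T₁ T₂ => ⟨?_, ?_⟩, fun C₁ C₂ => ⟨⟨_, C₁.isLUB_sup C₂⟩, ⟨_, C₁.isGLB_inf C₂⟩⟩,
    UTheory.cotheoryIso, fun _ _ _ => rfl⟩
  -- Bounds of theories are images of bounds of cotheories under the inverse isomorphism.
  · have h := (UTheory.cotheoryIso.symm.isLUB_image').2
      (BasicCotheory.isLUB_sup (UTheory.cotheoryIso T₁) (UTheory.cotheoryIso T₂))
    rw [Set.image_pair, OrderIso.symm_apply_apply, OrderIso.symm_apply_apply] at h
    exact ⟨_, h⟩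
  · have h := (UTheory.cotheoryIso.symm.isGLB_image').2
      (BasicCotheory.isGLB_inf (UTheory.cotheoryIso T₁) (UTheory.cotheoryIso T₂))
    rw [Set.image_pair, OrderIso.symm_apply_apply, OrderIso.symm_apply_apply] at h
    exact ⟨_, h⟩
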